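/- Let $\alpha$ be a probability measure on $\mathbb{R}$ such that $\int_{\mathbb{R}}\log(1+|x|)\,\alpha(dx)<\infty$ (that is, $\alpha\in FT_1$). For real $t>0$ let $B_1,Y_1,B_2,Y_2,\ldots$ be independent random variables with $B_n\sim\alpha$ and $Y_n\sim\beta(1,t)$, i.e. $Y_n$ has density $t(1-y)^{t-1}\mathbf{1}_{(0,1)}(y)$. Put $W_n=Y_n\prod_{k=1}^{n-1}(1-Y_k)$, and let $\mu(t\alpha)$ denote the distribution of the almost surely absolutely convergent series $X_t=\sum_{n=1}^{\infty}W_nB_n$ (the mean $\int x\,P_t(dx)$ of the Dirichlet random probability $P_t=\sum_{n\ge1}W_n\delta_{B_n}$). Let $N$ be an integer and suppose that $\mu(n\alpha)=\alpha$ for all integers $n\geq N$ with $n\ge 1$. Then $\alpha$ is either a Cauchy distribution, $\alpha(dx)=\frac{1}{\pi}\frac{b\,dx}{(x-a)^2+b^2}$ for some $a\in\mathbb{R}$ and $b>0$, or a Dirac mass $\delta_a$ for some $a\in\mathbb{R}$. -/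

import Mathlib

open MeasureTheory ProbabilityTheory

namespace DirichletCurve

/-- The class `FT₁`: probabilities `α` on `ℝ` with `∫ log (1 + |x|) α(dx) < ∞`. -/
structure FT₁ (α : Measure ℝ) : Prop where
  isProbabilityMeasure : IsProbabilityMeasure α
  lintegral_log_lt_top : ∫⁻ x, ENNReal.ofReal (Real.log (1 + |x|)) ∂α < ⊤

/-- The stick-breaking weights `W n = Y n * (1 - Y (n - 1)) * ⋯ * (1 - Y 0)`
(indexed from `0`). -/
noncomputable def stickWeight (Y : ℕ → ℝ) (n : ℕ) : ℝ :=
  Y n * ∏ k ∈ Finset.range n, (1 - Y k)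

/-- The law of the sequence `((B n, Y n))` in which all the `B n` and `Y n` are independent,
`B n ∼ α` and `Y n ∼ β(1, t)`, i.e. `Y n` has density `t (1 - y) ^ (t - 1)` on `(0, 1)`. -/
noncomputable def stickLaw (t : ℝ) (α : Measure ℝ) : Measure (ℕ → ℝ × ℝ) :=
  Measure.infinitePi fun _ => α.prod (betaMeasure 1 t)

/-- The random variable `X = ∑ n, W n * B n`, the mean of the random probability
`∑ n, W n • δ_{B n}`, as a function of the sequence `((B n, Y n))`. -/
noncomputable def stickMean (ω : ℕ → ℝ × ℝ) : ℝ :=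
  ∑' n, stickWeight (fun k => (ω k).2) n * (ω n).1

/-- `μ(tα)`: the distribution of the mean `∑ n, W n * B n` of the Dirichlet random probability
with governing probability `α` and intensity `t > 0`. For `α` in `FT₁` the series converges
absolutely almost surely, so that the default value of `∑'` plays no role. -/
noncomputable def dirichletMeanLaw (t : ℝ) (α : Measure ℝ) : Measure ℝ :=
  (stickLaw t α).map stickMean

/-- `α` is a (nondegenerate) Cauchy distribution: it has density
`π⁻¹ * b / ((x - a) ^ 2 + b ^ 2)` for some real `a` and some `b > 0`. -/
def IsCauchy (α : Measure ℝ) : Prop :=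
  ∃ (a : ℝ) (b : NNReal), 0 < b ∧ α = cauchyMeasure a b

/-- `α` is a Dirac mass on `ℝ`. -/
def IsDirac (α : Measure ℝ) : Prop :=
  ∃ a : ℝ, α = Measure.dirac a

end DirichletCurve

namespace DirichletCurve

open Complex BoundedContinuousFunction

/-- The function `x ↦ (1 - i x)⁻¹`, which maps `ℝ` into the circle of diameter `[0, 1]`. -/
noncomputable def halfCayley (x : ℝ) : ℂ := (1 - x * I)⁻¹

/-- The Cayley transform `x ↦ (1 + i x) / (1 - i x)` from `ℝ` to the unit circle. -/
noncomputable def cayley (x : ℝ) : ℂ := 2 * halfCayley x - 1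

lemma one_sub_mul_I_ne_zero (x : ℝ) : (1 - x * I : ℂ) ≠ 0 := fun h => by
  simpa using congrArg re h

lemma cayley_eq_div (x : ℝ) : cayley x = (1 + x * I) / (1 - x * I) := by
  have := one_sub_mul_I_ne_zero x
  rw [cayley, halfCayley]
  field_simp
  ring

lemma continuous_halfCayley : Continuous halfCayley := by
  unfold halfCayley
  exact Continuous.inv₀ (by fun_prop) one_sub_mul_I_ne_zero

lemma continuous_cayley : Continuous cayley := by
  unfold cayley
  have := continuous_halfCayley
  fun_prop

lemma norm_cayley (x : ℝ) : ‖cayley x‖ = 1 := by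
  have h : (1 + x * I : ℂ) = (starRingEnd ℂ) (1 - x * I) := by simp
  rw [cayley_eq_div, h, norm_div, RCLike.norm_conj, div_self]
  exact norm_ne_zero_iff.2 (one_sub_mul_I_ne_zero x)

lemma norm_halfCayley_le (x : ℝ) : ‖halfCayley x‖ ≤ 1 := by
  have h : halfCayley x = (cayley x + 1) / 2 := by rw [cayley]; ring
  rw [h, norm_div]
  have := norm_add_le (cayley x) 1
  rw [norm_cayley, norm_one] at this
  norm_num
  linarith

lemma re_halfCayley_pos (x : ℝ) : 0 < (halfCayley x).re := by
  rw [halfCayley, inv_re]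
  have := normSq_pos.2 (one_sub_mul_I_ne_zero x)
  have h : (1 - x * I : ℂ).re = 1 := by simp
  rw [h]
  positivity

lemma cayley_injective : Function.Injective cayley := fun x y h => by
  have h1 : (1 - x * I : ℂ) = 1 - y * I := by
    rw [cayley, cayley, sub_left_inj] at h
    exact inv_injective (mul_left_cancel₀ two_ne_zero h)
  simpa using congrArg im h1

/-- The Cayley transform as a bounded continuous function. -/
noncomputable def cayleyBCF : ℝ →ᵇ ℂ :=
  ofNormedAddCommGroup cayley continuous_cayley 1 fun x => (norm_cayley x).le

@[simp] lemma cayleyBCF_apply (x : ℝ) : cayleyBCF x = cayley x := rfl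

lemma cayleyBCF_mul_star : cayleyBCF * star cayleyBCF = 1 := by
  ext x
  simp [Complex.mul_conj, normSq_eq_norm_sq, norm_cayley]

/-- The star algebra generated by the Cayley transform. -/
noncomputable def cayleyAlgebra : StarSubalgebra ℂ (ℝ →ᵇ ℂ) :=
  StarAlgebra.adjoin ℂ {cayleyBCF}

lemma mem_closure_cayleyBCF {f : ℝ →ᵇ ℂ}
    (hf : f ∈ Submonoid.closure ({cayleyBCF} ∪ star {cayleyBCF})) :
    ∃ k : ℕ, f = cayleyBCF ^ k ∨ f = star cayleyBCF ^ k := by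
  induction hf using Submonoid.closure_induction_left with
  | one => exact ⟨0, by simp⟩
  | mul_left x hx y _ ih =>
    obtain ⟨k, hk⟩ := ih
    have hx' : x = cayleyBCF ∨ x = star cayleyBCF := by
      simpa only [Set.star_singleton, Set.mem_union, Set.mem_singleton_iff] using hx
    have h1 := cayleyBCF_mul_star
    have h2 : star cayleyBCF * cayleyBCF = 1 := by rw [mul_comm, h1]
    rcases k with _ | k
    · refine ⟨1, ?_⟩
      have : y = 1 := by simpa using hk
      simpa [this] using hx'
    rcases hx' with rfl | rfl <;> rcases hk with rfl | rfl
    · exact ⟨k + 2, Or.inl (by ring)⟩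
    · exact ⟨k, Or.inr (by rw [pow_succ', ← mul_assoc, h1, one_mul])⟩
    · exact ⟨k, Or.inl (by rw [pow_succ', ← mul_assoc, h2, one_mul])⟩
    · exact ⟨k + 2, Or.inr (by ring)⟩

/-- A finite measure on `ℝ` is determined by the moments of the Cayley transform. -/
theorem ext_of_integral_cayley_pow {P Q : Measure ℝ} [IsFiniteMeasure P] [IsFiniteMeasure Q]
    (h : ∀ k : ℕ, ∫ x, cayley x ^ k ∂P = ∫ x, cayley x ^ k ∂Q) : P = Q := by
  refine ext_of_forall_mem_subalgebra_integral_eq_of_polish (𝕜 := ℂ) (A := cayleyAlgebra)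
    (fun x y hxy => ⟨cayley, ⟨toContinuousMapStarₐ ℂ cayleyBCF, ⟨cayleyBCF,
      StarAlgebra.subset_adjoin ℂ _ rfl, rfl⟩, rfl⟩, cayley_injective.ne hxy⟩) fun g hg => ?_
  have key : ∀ f ∈ Submodule.span ℂ
      (Submonoid.closure ({cayleyBCF} ∪ star {cayleyBCF}) : Set (ℝ →ᵇ ℂ)),
      ∫ x, f x ∂P = ∫ x, f x ∂Q := fun f hf => by
    induction hf using Submodule.span_induction with
    | mem f hf =>
      obtain ⟨k, rfl | rfl⟩ := mem_closure_cayleyBCF hf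
      · simpa using h k
      · have := congrArg (starRingEnd ℂ) (h k)
        rw [← integral_conj, ← integral_conj] at this
        simpa using this
    | zero => simp
    | add f g _ _ hf hg =>
      simp only [BoundedContinuousFunction.coe_add, Pi.add_apply]
      rw [integral_add (f.integrable P) (g.integrable P),
        integral_add (f.integrable Q) (g.integrable Q), hf, hg]
    | smul c f _ hf =>
      simp only [BoundedContinuousFunction.coe_smul]
      rw [integral_smul, integral_smul, hf]
  refine key g ?_
  rw [← Algebra.adjoin_eq_span, ← StarAlgebra.adjoin_toSubalgebra]
  exact hg

lemma eq_zero_of_bounded_recurrence {g : ℕ → ℕ → ℂ} {C : ℝ}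
    (hrec : ∀ j k, 2 * g (j + 1) k = g j k + g j (k + 1)) (hC : ∀ j k, ‖g j k‖ ≤ C)
    (h0 : g 0 0 = 0) (M : ℕ) (hM : ∀ k, g M k = 0) (k : ℕ) : g 0 k = 0 := by
  induction M generalizing k with
  | zero => exact hM k
  | succ M ih =>
    refine ih (fun k => ?_) k
    have hsign : ∀ k, g M k = (-1) ^ k * g M 0 := fun k => by
      induction k with
      | zero => simp
      | succ k hk =>
        have := hrec M k
        rw [hM, hk] at this
        rw [pow_succ]
        linear_combination -this
    suffices hz : g M 0 = 0 by rw [hsign, hz, mul_zero]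
    rcases M with _ | M
    · exact h0
    have hlin : ∀ k : ℕ, (-1) ^ k * g M k = g M 0 - 2 * k * g (M + 1) 0 := fun k => by
      induction k with
      | zero => simp
      | succ k hk =>
        have h1 := hrec M k
        rw [hsign] at h1
        have h2 : ((-1 : ℂ) ^ k) * (-1) ^ k = 1 := by rw [← mul_pow]; simp
        rw [pow_succ]
        push_cast
        linear_combination hk + (-1) ^ k * h1 - 2 * g (M + 1) 0 * h2
    by_contra hne
    obtain ⟨n, hn⟩ := exists_nat_gt (C / ‖g (M + 1) 0‖)
    rw [div_lt_iff₀ (norm_pos_iff.2 hne)] at hn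
    have h3 : 2 * n * g (M + 1) 0 = g M 0 - (-1) ^ n * g M n := by rw [hlin]; ring
    have h4 := (congrArg norm h3).trans_le (norm_sub_le _ _)
    simp only [norm_mul, norm_pow, norm_neg, norm_one, one_pow, one_mul, Complex.norm_natCast,
      Complex.norm_ofNat] at h4
    linarith [hC M 0, hC M n]

lemma integrable_halfCayley_pow_mul (P : Measure ℝ) [IsFiniteMeasure P] (j k : ℕ) :
    Integrable (fun x => halfCayley x ^ j * cayley x ^ k) P := by
  have h1 := continuous_halfCayley
  have h2 := continuous_cayley
  refine Integrable.of_bound (C := 1) (by fun_prop) (.of_forall fun x => ?_)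
  rw [norm_mul, norm_pow, norm_pow, norm_cayley, one_pow, mul_one]
  exact pow_le_one₀ (norm_nonneg _) (norm_halfCayley_le x)

/-- If the moments of `(1 - i X)⁻¹` are eventually geometric, with ratio the mean, then so are
all moments of the Cayley transform. -/
lemma integral_cayley_pow_of_eventually {P : Measure ℝ} [IsProbabilityMeasure P] {M : ℕ}
    (h : ∀ n, M ≤ n →
      ∫ x, halfCayley x ^ (n + 1) ∂P = (∫ x, halfCayley x ^ n ∂P) * ∫ x, halfCayley x ∂P)
    (k : ℕ) : ∫ x, cayley x ^ k ∂P = (2 * (∫ x, halfCayley x ∂P) - 1) ^ k := by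
  set c := ∫ x, halfCayley x ∂P with hc
  set m : ℕ → ℕ → ℂ := fun j k => ∫ x, halfCayley x ^ j * cayley x ^ k ∂P with hm
  have hint := integrable_halfCayley_pow_mul P
  have hmrec : ∀ j k, 2 * m (j + 1) k = m j k + m j (k + 1) := fun j k => by
    simp only [hm]
    rw [← integral_const_mul, ← integral_add (hint _ _) (hint _ _)]
    congr 1 with x
    have : halfCayley x = (cayley x + 1) / 2 := by rw [cayley]; ring
    rw [pow_succ (halfCayley x) j]
    linear_combination 2 * halfCayley x ^ j * cayley x ^ k * this
  have hmle : ∀ j k, ‖m j k‖ ≤ 1 := fun j k => by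
    refine (norm_integral_le_of_norm_le_const (C := 1) (.of_forall fun x => ?_)).trans (by simp)
    rw [norm_mul, norm_pow, norm_pow, norm_cayley, one_pow, mul_one]
    exact pow_le_one₀ (norm_nonneg _) (norm_halfCayley_le x)
  set g : ℕ → ℕ → ℂ := fun j k => m (j + 1) k - c * m j k with hg
  have hrec : ∀ j k, 2 * g (j + 1) k = g j k + g j (k + 1) := fun j k => by
    simp only [hg]
    linear_combination hmrec (j + 1) k - c * hmrec j k
  have hgM : ∀ k j, M ≤ j → g j k = 0 := fun k => by
    induction k with
    | zero =>
      intro j hj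
      simp only [hg, hm, pow_zero, mul_one]
      rw [h j hj]
      ring
    | succ k ih =>
      intro j hj
      have := hrec j k
      rw [ih j hj, ih (j + 1) (by omega)] at this
      linear_combination -this
  have hg0 : ∀ k, g 0 k = 0 := by
    refine eq_zero_of_bounded_recurrence (C := 1 + ‖c‖) hrec (fun j k => ?_) ?_ M
      (fun k => hgM k M le_rfl)
    · refine (norm_sub_le _ _).trans (add_le_add (hmle _ _) ?_)
      rw [norm_mul]
      exact mul_le_of_le_one_right (norm_nonneg _) (hmle _ _)
    · simp [hg, hm, hc]
  have hstep : ∀ k, m 0 (k + 1) = (2 * c - 1) * m 0 k := fun k => by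
    have h1 := hg0 k
    simp only [hg] at h1
    linear_combination 2 * h1 - hmrec 0 k
  have hfin : ∀ k, m 0 k = (2 * c - 1) ^ k := fun k => by
    induction k with
    | zero => simp [hm]
    | succ k ih => rw [hstep, ih, pow_succ']
  simpa [hm] using hfin k

/-- The moments of the Cayley transform under a Cauchy distribution. -/
lemma integral_cayley_pow_cauchyMeasure (a : ℝ) {b : NNReal} (hb : 0 < b) (k : ℕ) :
    ∫ x, cayley x ^ k ∂(cauchyMeasure a b) = (2 * (1 + b - a * I : ℂ)⁻¹ - 1) ^ k := by
  have hb' : (0 : ℝ) < b := hb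
  set F : ℂ → ℂ := fun w =>
    (2 * ((w + 1) * ((1 - a * I - b) * w + (1 - a * I + b))⁻¹) - 1) ^ k with hF
  have hden : ∀ w ∈ Metric.closedBall (0 : ℂ) 1,
      (1 - a * I - b : ℂ) * w + (1 - a * I + b) ≠ 0 := fun w hw h => by
    rw [mem_closedBall_zero_iff] at hw
    have h1 : ‖(1 - a * I + b : ℂ)‖ ≤ ‖(1 - a * I - b : ℂ)‖ := by
      rw [show (1 - a * I + b : ℂ) = -((1 - a * I - b) * w) by linear_combination h, norm_neg,
        norm_mul]
      exact mul_le_of_le_one_right (norm_nonneg _) hw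
    rw [← sq_le_sq₀ (norm_nonneg _) (norm_nonneg _), ← normSq_eq_norm_sq, ← normSq_eq_norm_sq,
      normSq_apply, normSq_apply] at h1
    simp at h1
    nlinarith
  have hmean : Real.circleAverage F 0 1 = F 0 := by
    refine DiffContOnCl.circleAverage
      (DifferentiableOn.diffContOnCl_ball (U := Metric.closedBall 0 1) ?_ (by simp))
    intro w hw
    have := hden w hw
    fun_prop (disch := assumption)
  have hF0 : F 0 = (2 * (1 + b - a * I : ℂ)⁻¹ - 1) ^ k := by
    simp only [hF]; ring_nf
  have hpt : ∀ u ∈ Set.Ioo (-(Real.pi / 2)) (Real.pi / 2),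
      cayley (a + b * Real.tan u) ^ k = F (circleMap 0 1 (2 * u)) := fun u hu => by
    have hcos : (Real.cos u : ℂ) ≠ 0 := by exact_mod_cast (Real.cos_pos_of_mem_Ioo hu).ne'
    have hw : circleMap 0 1 (2 * u) = (Real.cos u + Real.sin u * I) ^ 2 := by
      simp only [circleMap, ofReal_one, one_mul, zero_add]
      rw [ofReal_cos, ofReal_sin, ← Complex.exp_mul_I, ← Complex.exp_nat_mul]
      push_cast
      ring_nf
    have hcs : (Real.cos u : ℂ) ^ 2 + (Real.sin u : ℂ) ^ 2 = 1 := by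
      exact_mod_cast Real.cos_sq_add_sin_sq u
    have hz := hden (circleMap 0 1 (2 * u)) (by simp)
    have hx := one_sub_mul_I_ne_zero (a + b * Real.tan u)
    suffices halfCayley (a + b * Real.tan u) = (circleMap 0 1 (2 * u) + 1) *
        ((1 - a * I - b) * circleMap 0 1 (2 * u) + (1 - a * I + b))⁻¹ by
      simp only [hF, cayley, this]
    rw [halfCayley, ← div_eq_mul_inv, eq_div_iff hz, inv_mul_eq_iff_eq_mul₀ hx, hw,
      Real.tan_eq_sin_div_cos]
    simp only [ofReal_add, ofReal_mul, ofReal_div]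
    generalize (Real.cos u : ℂ) = s at *
    generalize (Real.sin u : ℂ) = t at *
    field_simp
    linear_combination -(b : ℂ) * (s + t * I) * hcs + b * t ^ 2 * (s + t * I) * I_sq
  rw [cauchyMeasure, if_neg hb.ne',
    integral_withDensity_eq_integral_toReal_smul (by fun_prop) (by simp [cauchyPDF])]
  have himg : (fun u => a + b * Real.tan u) '' Set.Ioo (-(Real.pi / 2)) (Real.pi / 2) =
      Set.univ := by
    refine Set.eq_univ_of_forall fun x => ?_
    obtain ⟨u, hu, hx⟩ := Real.surjOn_tan (Set.mem_univ ((x - a) / b))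
    exact ⟨u, hu, by simp only [hx]; field_simp; ring⟩
  rw [← setIntegral_univ, ← himg, integral_image_eq_integral_abs_deriv_smul
    (f' := fun u => b * (1 / Real.cos u ^ 2)) measurableSet_Ioo
    (fun u hu => (((Real.hasDerivAt_tan (Real.cos_pos_of_mem_Ioo hu).ne').const_mul
      (b : ℝ)).const_add a).hasDerivWithinAt)
    (fun u hu v hv h => Real.injOn_tan hu hv (by simpa [hb'.ne'] using h))]
  have hcongr : ∀ u ∈ Set.Ioo (-(Real.pi / 2)) (Real.pi / 2),
      |b * (1 / Real.cos u ^ 2)| • ((cauchyPDF a b (a + b * Real.tan u)).toReal •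
        cayley (a + b * Real.tan u) ^ k) = Real.pi⁻¹ • F (circleMap 0 1 (2 * u)) := fun u hu => by
    have hcos := Real.cos_pos_of_mem_Ioo hu
    rw [hpt u hu, smul_smul, cauchyPDF, ENNReal.toReal_ofReal (cauchyPDF_pos a hb.ne' _).le,
      cauchyPDFReal, abs_of_pos (by positivity), Real.tan_eq_sin_div_cos]
    congr 1
    have := Real.cos_sq_add_sin_sq u
    field_simp
    linear_combination -(b : ℝ) ^ 2 * this
  rw [setIntegral_congr_fun measurableSet_Ioo hcongr, ← integral_Ioc_eq_integral_Ioo,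
    ← intervalIntegral.integral_of_le (by linarith [Real.pi_pos]), intervalIntegral.integral_smul,
    intervalIntegral.integral_comp_mul_left (fun θ => F (circleMap 0 1 θ)) two_ne_zero, ← hF0,
    ← hmean, Real.circleAverage_eq_integral_add (-Real.pi),
    intervalIntegral.integral_comp_add_right (fun θ => F (circleMap 0 1 θ)), smul_smul,
    mul_inv, mul_comm]
  congr 2 <;> ring

lemma integral_cayley_pow_dirac (a : ℝ) (k : ℕ) :
    ∫ x, cayley x ^ k ∂(Measure.dirac a) = (2 * (1 - a * I : ℂ)⁻¹ - 1) ^ k := by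
  simp [cayley, halfCayley]

/-- A probability all of whose Cayley moments are the powers of the first one is Cauchy or
Dirac. -/
theorem isCauchy_or_isDirac_of_integral_cayley_pow {P : Measure ℝ} [IsProbabilityMeasure P]
    (h : ∀ k : ℕ, ∫ x, cayley x ^ k ∂P = (2 * (∫ x, halfCayley x ∂P) - 1) ^ k) :
    IsCauchy P ∨ IsDirac P := by
  set c := ∫ x, halfCayley x ∂P with hc
  have hint : Integrable halfCayley P := by
    simpa using integrable_halfCayley_pow_mul P 1 0
  have hcre : 0 < c.re := by
    rw [hc, ← RCLike.re_to_complex, ← integral_re hint]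
    change 0 < ∫ x, (halfCayley x).re ∂P
    rw [integral_pos_iff_support_of_nonneg (fun x => (re_halfCayley_pos x).le) hint.re]
    have : Function.support (fun x => (halfCayley x).re) = Set.univ :=
      Set.eq_univ_of_forall fun x => (re_halfCayley_pos x).ne'
    simp [this]
  have hc0 : c ≠ 0 := fun h => by simp [h] at hcre
  have hω : ‖2 * c - 1‖ ≤ 1 := by
    rw [← pow_one (2 * c - 1), ← h 1]
    refine (norm_integral_le_of_norm_le_const (C := 1) (.of_forall fun x => ?_)).trans (by simp)
    rw [pow_one, norm_cayley]
  have hb : 0 ≤ c⁻¹.re - 1 := by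
    have h1 : c.re * c.re + c.im * c.im ≤ c.re := by
      rw [← sq_le_one_iff₀ (norm_nonneg _), ← normSq_eq_norm_sq, normSq_apply] at hω
      simp at hω
      nlinarith
    rw [inv_re, normSq_apply, sub_nonneg, le_div_iff₀ (by nlinarith [mul_self_nonneg c.im])]
    linarith
  have hcK : c⁻¹ = 1 + (c⁻¹.re - 1 : ℝ) - (-c⁻¹.im : ℝ) * I := by
    apply Complex.ext <;> simp
  rcases hb.eq_or_lt with hb | hb
  · refine Or.inr ⟨-c⁻¹.im, ext_of_integral_cayley_pow fun k => ?_⟩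
    rw [← hb] at hcK
    rw [h, integral_cayley_pow_dirac, ← inv_inv c, hcK]
    simp
  · obtain ⟨b, hbe⟩ : ∃ b : NNReal, (b : ℝ) = c⁻¹.re - 1 := ⟨⟨_, hb.le⟩, rfl⟩
    rw [← hbe] at hb hcK
    refine Or.inl ⟨-c⁻¹.im, b, hb, ext_of_integral_cayley_pow fun k => ?_⟩
    rw [h, integral_cayley_pow_cauchyMeasure _ hb, ← hcK, inv_inv]

section Shift

variable {X : Type*} [MeasurableSpace X]

/-- Under a power measure on sequences, the first coordinate and the shifted sequence are
independent, the latter having the original law. -/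
lemma infinitePi_map_zero_shift (ν : Measure X) [IsProbabilityMeasure ν] :
    (Measure.infinitePi fun _ : ℕ => ν).map (fun ω => (ω 0, fun k => ω (k + 1))) =
      ν.prod (Measure.infinitePi fun _ : ℕ => ν) := by
  set P := Measure.infinitePi fun _ : ℕ => ν with hP
  have hind : iIndepFun (fun (i : ℕ) (ω : ℕ → X) => ω i) P :=
    iIndepFun_infinitePi (X := fun _ x => x) (by fun_prop)
  have h0 : P.map (fun ω => ω 0) = ν := Measure.infinitePi_map_eval _ 0
  have h1 : P.map (fun ω k => ω (k + 1)) = P :=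
    Measure.map_infinitePi_infinitePi_of_inj (P := fun _ : ℕ => ν) (add_left_injective 1)
  have hindep : IndepFun (fun ω : ℕ → X => ω 0) (fun ω k => ω (k + 1)) P := by
    have hsup := indep_iSup_of_disjoint (S := {0}) (T := {i | i ≠ 0})
      (fun i => (measurable_pi_apply i).comap_le) hind.iIndep (by simp)
    refine (IndepFun_iff_Indep _ _ _).2
      (indep_of_indep_of_le_left (indep_of_indep_of_le_right hsup ?_) ?_)
    · rw [MeasurableSpace.pi, MeasurableSpace.comap_iSup]
      refine iSup_le fun k => ?_
      rw [MeasurableSpace.comap_comp]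
      exact le_iSup₂_of_le (k + 1) k.succ_ne_zero le_rfl
    · exact le_iSup₂_of_le 0 rfl le_rfl
  rw [(indepFun_iff_map_prod_eq_prod_map_map
    (Measurable.aemeasurable (by fun_prop)) (Measurable.aemeasurable (by fun_prop))).1 hindep,
    h0, h1]

end Shift

section Summability

open ENNReal

lemma ae_mem_Ioo_betaMeasure (a b : ℝ) : ∀ᵐ y ∂(betaMeasure a b), y ∈ Set.Ioo (0 : ℝ) 1 := by
  rw [betaMeasure, ae_withDensity_iff (by unfold betaPDF; fun_prop)]
  filter_upwards with y hy
  by_contra h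
  refine hy ?_
  rw [betaPDF_eq, if_neg (by simpa using h), ENNReal.ofReal_zero]

lemma lintegral_one_sub_betaMeasure_lt_one {t : ℝ} (ht : 0 < t) :
    ∫⁻ y, ENNReal.ofReal (1 - y) ∂(betaMeasure 1 t) < 1 := by
  have := isProbabilityMeasureBeta one_pos ht
  have hpos : ∀ᵐ y ∂(betaMeasure 1 t), 0 < y :=
    (ae_mem_Ioo_betaMeasure 1 t).mono fun y hy => hy.1
  calc ∫⁻ y, ENNReal.ofReal (1 - y) ∂(betaMeasure 1 t) < ∫⁻ y, 1 ∂(betaMeasure 1 t) := by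
        refine lintegral_strict_mono (IsProbabilityMeasure.ne_zero _) (by fun_prop) ?_ ?_
        · refine ne_top_of_le_ne_top (b := ∫⁻ y, 1 ∂(betaMeasure 1 t)) (by simp)
            (lintegral_mono_ae ?_)
          filter_upwards [hpos] with y hy
          exact ENNReal.ofReal_le_one.2 (by linarith)
        · filter_upwards [hpos] with y hy
          exact ENNReal.ofReal_lt_one.2 (by linarith)
    _ = 1 := by simp

variable {Ω : Type*} [MeasurableSpace Ω]

/-- Products of independent copies of a nonnegative variable with mean less than one decay
geometrically. -/
lemma ae_exists_prod_le_geometric {P : Measure Ω} [IsProbabilityMeasure P] {U : ℕ → Ω → ℝ≥0∞}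
    (hU : ∀ n, Measurable (U n)) (hind : iIndepFun U P) {r ρ : ℝ≥0∞}
    (hmean : ∀ n, ∫⁻ ω, U n ω ∂P = r) (hrρ : r < ρ) (hρ : ρ ≠ ⊤) :
    ∀ᵐ ω ∂P, ∃ C : ℝ≥0∞, C ≠ ⊤ ∧ ∀ n, ∏ k ∈ Finset.range n, U k ω ≤ C * ρ ^ n := by
  have hρ0 : ρ ≠ 0 := (bot_le.trans_lt hrρ).ne'
  have hprod : ∀ n, ∫⁻ ω, ∏ k ∈ Finset.range n, U k ω ∂P = r ^ n := fun n => by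
    have := lintegral_prod_eq_prod_lintegral_of_indepFun (Finset.range n) U hind hU
    rw [this]
    simp [hmean]
  have hsum : ∫⁻ ω, ∑' n, (∏ k ∈ Finset.range n, U k ω) * (ρ⁻¹) ^ n ∂P ≠ ⊤ := by
    rw [lintegral_tsum (fun n => by fun_prop)]
    simp_rw [lintegral_mul_const _ (Finset.measurable_prod _ fun k _ => hU k), hprod, ← mul_pow]
    rw [ENNReal.tsum_geometric]
    refine ENNReal.inv_ne_top.2 (tsub_pos_of_lt ?_).ne'
    rw [← div_eq_mul_inv, ENNReal.div_lt_iff (Or.inl hρ0) (Or.inl hρ), one_mul]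
    exact hrρ
  filter_upwards [ae_lt_top' (by fun_prop) hsum] with ω hω
  refine ⟨_, hω.ne, fun n => ?_⟩
  calc ∏ k ∈ Finset.range n, U k ω
      = (∏ k ∈ Finset.range n, U k ω) * (ρ⁻¹) ^ n * ρ ^ n := by
        rw [mul_assoc, ← mul_pow, ENNReal.inv_mul_cancel hρ0 hρ, one_pow, mul_one]
    _ ≤ _ := by gcongr; exact ENNReal.le_tsum n

/-- Identically distributed variables with a logarithmic moment grow subexponentially. -/
lemma ae_eventually_abs_le_exp {α : Measure ℝ} (hα : FT₁ α) {P : Measure Ω} {B : ℕ → Ω → ℝ}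
    (hB : ∀ n, MeasurePreserving (B n) P α) {ε : ℝ} (hε : 0 < ε) :
    ∀ᵐ ω ∂P, ∀ᶠ n : ℕ in Filter.atTop, |B n ω| ≤ Real.exp (ε * n) := by
  have := hα.isProbabilityMeasure
  have hnn : ∀ x : ℝ, 0 ≤ Real.log (1 + |x|) := fun x =>
    Real.log_nonneg (by linarith [abs_nonneg x])
  have hmeas : Measurable fun x : ℝ => Real.log (1 + |x|) := by fun_prop
  have hint : Integrable (fun x : ℝ => Real.log (1 + |x|) / ε) α := by
    refine Integrable.div_const ⟨hmeas.aestronglyMeasurable, ?_⟩ ε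
    rw [hasFiniteIntegral_iff_ofReal (.of_forall hnn)]
    exact hα.lintegral_log_lt_top
  have hsum : ∑' j : ℕ, α {x | Real.log (1 + |x|) / ε ∈ Set.Ioi (j : ℝ)} < ⊤ :=
    letI : MeasureSpace ℝ := ⟨α⟩
    tsum_prob_mem_Ioi_lt_top hint fun x => div_nonneg (hnn x) hε.le
  have hset : ∀ j : ℕ, MeasurableSet {x : ℝ | Real.log (1 + |x|) / ε ∈ Set.Ioi (j : ℝ)} :=
    fun j => (hmeas.div_const ε) measurableSet_Ioi
  have hsum' : ∑' j : ℕ, P (B j ⁻¹' {x | Real.log (1 + |x|) / ε ∈ Set.Ioi (j : ℝ)}) ≠ ⊤ := by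
    simp_rw [fun j => (hB j).measure_preimage (hset j).nullMeasurableSet]
    exact hsum.ne
  filter_upwards [ae_eventually_notMem hsum'] with ω hω
  filter_upwards [hω] with n hn
  simp only [Set.mem_preimage, Set.mem_ofPred_eq, Set.mem_Ioi, not_lt] at hn
  rw [div_le_iff₀ hε, Real.log_le_iff_le_exp (by positivity)] at hn
  rw [mul_comm]
  linarith

lemma ae_summable_stickWeight_mul {α : Measure ℝ} (hα : FT₁ α) {t : ℝ} (ht : 0 < t) :
    ∀ᵐ ω ∂(stickLaw t α), Summable fun n => stickWeight (fun k => (ω k).2) n * (ω n).1 := by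
  have := hα.isProbabilityMeasure
  have := isProbabilityMeasureBeta one_pos ht
  have hfst : ∀ n : ℕ, MeasurePreserving (fun ω : ℕ → ℝ × ℝ => (ω n).1) (stickLaw t α) α :=
    fun n => measurePreserving_fst.comp (measurePreserving_eval_infinitePi _ n)
  have hsnd : ∀ n : ℕ, MeasurePreserving (fun ω : ℕ → ℝ × ℝ => (ω n).2) (stickLaw t α)
      (betaMeasure 1 t) :=
    fun n => measurePreserving_snd.comp (measurePreserving_eval_infinitePi _ n)
  have : IsProbabilityMeasure (stickLaw t α) := by unfold stickLaw; infer_instance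
  obtain ⟨ρ, hrρ, hρ1⟩ := exists_between (lintegral_one_sub_betaMeasure_lt_one ht)
  have hρtop : ρ ≠ ⊤ := (hρ1.trans one_lt_top).ne
  have hρ0 : 0 < ρ.toReal := ENNReal.toReal_pos (bot_le.trans_lt hrρ).ne' hρtop
  have hρ1' : ρ.toReal < 1 := by
    rw [← ENNReal.toReal_one]; exact (ENNReal.toReal_lt_toReal hρtop one_ne_top).2 hρ1
  obtain ⟨s, hs1, hs⟩ := exists_between ((one_lt_inv₀ hρ0).2 hρ1')
  set U : ℕ → (ℕ → ℝ × ℝ) → ℝ≥0∞ := fun n ω => ENNReal.ofReal (1 - (ω n).2) with hUdef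
  have hU : ∀ n, Measurable (U n) := fun n => by fun_prop
  have hind : iIndepFun U (stickLaw t α) :=
    iIndepFun_infinitePi (P := fun _ : ℕ => α.prod (betaMeasure 1 t))
      (X := fun _ p => ENNReal.ofReal (1 - p.2)) (fun _ => by fun_prop)
  have hmean : ∀ n, ∫⁻ ω, U n ω ∂(stickLaw t α) =
      ∫⁻ y, ENNReal.ofReal (1 - y) ∂(betaMeasure 1 t) := fun n =>
    (hsnd n).lintegral_comp (f := fun y => ENNReal.ofReal (1 - y)) (by fun_prop)
  have hgeom := ae_exists_prod_le_geometric hU hind hmean hrρ hρtop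
  have hIoo : ∀ᵐ ω ∂(stickLaw t α), ∀ n, (ω n).2 ∈ Set.Ioo (0 : ℝ) 1 :=
    ae_all_iff.2 fun n => (hsnd n).quasiMeasurePreserving.ae (ae_mem_Ioo_betaMeasure 1 t)
  filter_upwards [hgeom, hIoo, ae_eventually_abs_le_exp hα hfst (Real.log_pos hs1)]
    with ω ⟨C, hC, hCle⟩ hω hB
  have hT : ∀ n, ∏ k ∈ Finset.range n, (1 - (ω k).2) ≤ C.toReal * ρ.toReal ^ n := fun n => by
    have h := ENNReal.toReal_mono (by finiteness) (hCle n)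
    rw [ENNReal.toReal_prod, ENNReal.toReal_mul, ENNReal.toReal_pow] at h
    convert! h using 2 with k
    exact (ENNReal.toReal_ofReal (by linarith [(hω k).2])).symm
  have hs0 : 0 < s := one_pos.trans hs1
  have hsum : Summable fun n : ℕ => C.toReal * (ρ.toReal * s) ^ n :=
    (summable_geometric_of_lt_one (by positivity)
      (by simpa [hρ0.ne'] using mul_lt_mul_of_pos_left hs hρ0)).mul_left _
  refine hsum.of_norm_bounded_eventually_nat ?_
  filter_upwards [hB] with n hn
  rw [mul_comm (Real.log s), Real.exp_nat_mul, Real.exp_log hs0] at hn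
  have hT0 : 0 ≤ ∏ k ∈ Finset.range n, (1 - (ω k).2) :=
    Finset.prod_nonneg fun k _ => by linarith [(hω k).2]
  rw [norm_mul, Real.norm_eq_abs, Real.norm_eq_abs, stickWeight, mul_pow, ← mul_assoc,
    abs_of_nonneg (mul_nonneg (hω n).1.le hT0)]
  exact mul_le_mul ((mul_le_of_le_one_left hT0 (hω n).2.le).trans (hT n)) hn (abs_nonneg _)
    (by positivity)

end Summability

lemma stickWeight_succ (Y : ℕ → ℝ) (n : ℕ) :
    stickWeight Y (n + 1) = (1 - Y 0) * stickWeight (fun k => Y (k + 1)) n := by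
  rw [stickWeight, stickWeight, Finset.prod_range_succ']
  ring

lemma stickMean_eq {ω : ℕ → ℝ × ℝ}
    (h : Summable fun n => stickWeight (fun k => (ω k).2) n * (ω n).1) :
    stickMean ω = (1 - (ω 0).2) * stickMean (fun k => ω (k + 1)) + (ω 0).2 * (ω 0).1 := by
  rw [stickMean, h.tsum_eq_zero_add, stickMean, ← tsum_mul_left, add_comm]
  congr 1
  · simp_rw [stickWeight_succ, mul_assoc]
  · simp [stickWeight]

lemma aemeasurable_stickMean {α : Measure ℝ} (hα : FT₁ α) {t : ℝ} (ht : 0 < t) :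
    AEMeasurable stickMean (stickLaw t α) := by
  refine aemeasurable_of_tendsto_metrizable_ae Filter.atTop
    (f := fun N ω => ∑ n ∈ Finset.range N, stickWeight (fun k => (ω k).2) n * (ω n).1)
    (fun N => ?_) ?_
  · unfold stickWeight
    exact Measurable.aemeasurable (by fun_prop)
  · filter_upwards [ae_summable_stickWeight_mul hα ht] with ω hω
    exact hω.hasSum.tendsto_sum_nat

lemma isProbabilityMeasure_dirichletMeanLaw {α : Measure ℝ} (hα : FT₁ α) {t : ℝ} (ht : 0 < t) :
    IsProbabilityMeasure (dirichletMeanLaw t α) := by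
  have := hα.isProbabilityMeasure
  have := isProbabilityMeasureBeta one_pos ht
  have : IsProbabilityMeasure (stickLaw t α) := by unfold stickLaw; infer_instance
  exact Measure.isProbabilityMeasure_map (aemeasurable_stickMean hα ht)

/-- The mean `X` of a Dirichlet random probability has the law of `(1 - Y) X + Y B`, where
`B`, `Y`, `X` are independent, `B ∼ α` and `Y ∼ β(1, t)`. -/
theorem dirichletMeanLaw_eq_map {α : Measure ℝ} (hα : FT₁ α) {t : ℝ} (ht : 0 < t) :
    dirichletMeanLaw t α = ((α.prod (betaMeasure 1 t)).prod (dirichletMeanLaw t α)).map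
      (fun q => (1 - q.1.2) * q.2 + q.1.2 * q.1.1) := by
  have := hα.isProbabilityMeasure
  have := isProbabilityMeasureBeta one_pos ht
  have : IsProbabilityMeasure (stickLaw t α) := by unfold stickLaw; infer_instance
  have hae := aemeasurable_stickMean hα ht
  set m := hae.mk stickMean with hm
  have hmm : Measurable m := hae.measurable_mk
  have hshift : MeasurePreserving (fun (ω : ℕ → ℝ × ℝ) k => ω (k + 1)) (stickLaw t α)
      (stickLaw t α) :=
    ⟨by fun_prop, Measure.map_infinitePi_infinitePi_of_inj
      (P := fun _ : ℕ => α.prod (betaMeasure 1 t)) (add_left_injective 1)⟩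
  have hlaw : dirichletMeanLaw t α = (stickLaw t α).map m := Measure.map_congr hae.ae_eq_mk
  set g : (ℝ × ℝ) × ℝ → ℝ := fun q => (1 - q.1.2) * q.2 + q.1.2 * q.1.1 with hg
  have hgm : Measurable g := by fun_prop
  have hrec : stickMean =ᵐ[stickLaw t α] fun ω => g (ω 0, m fun k => ω (k + 1)) := by
    filter_upwards [ae_summable_stickWeight_mul hα ht,
      hshift.quasiMeasurePreserving.ae_eq_comp hae.ae_eq_mk] with ω hω hω'
    rw [stickMean_eq hω]
    simp only [Function.comp_apply] at hω'
    rw [hω']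
  have hpair : (stickLaw t α).map (fun ω => (ω 0, fun k => ω (k + 1))) =
      (α.prod (betaMeasure 1 t)).prod (stickLaw t α) := infinitePi_map_zero_shift _
  have hprod : (α.prod (betaMeasure 1 t)).prod (dirichletMeanLaw t α) =
      ((α.prod (betaMeasure 1 t)).prod (stickLaw t α)).map (Prod.map id m) := by
    rw [hlaw, ← Measure.map_prod_map _ _ measurable_id hmm, Measure.map_id]
  rw [hprod, ← hpair, Measure.map_map hgm (by fun_prop),
    Measure.map_map (by fun_prop) (by fun_prop), dirichletMeanLaw, Measure.map_congr hrec]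
  rfl

lemma integral_betaMeasure_one_nat {n : ℕ} (hn : n ≠ 0) (f : ℝ → ℂ) :
    ∫ y, f y ∂(betaMeasure 1 n) = ∫ y in (0 : ℝ)..1, (n * (1 - y) ^ (n - 1) : ℝ) • f y := by
  have hn' : (0 : ℝ) < n := by positivity
  have hbeta : 1 / beta 1 n = n := by
    rw [beta, add_comm, Real.Gamma_add_one hn'.ne', Real.Gamma_one]
    have := (Real.Gamma_pos_of_pos hn').ne'
    field_simp
  rw [betaMeasure, integral_withDensity_eq_integral_toReal_smul (by unfold betaPDF; fun_prop)
    (by simp [betaPDF]), intervalIntegral.integral_of_le zero_le_one,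
    integral_Ioc_eq_integral_Ioo, ← integral_indicator measurableSet_Ioo]
  congr 1 with y
  by_cases hy : y ∈ Set.Ioo (0 : ℝ) 1
  · rw [Set.indicator_of_mem hy, betaPDF_of_pos_lt_one hy.1 hy.2, hbeta, sub_self,
      Real.rpow_zero, mul_one, ← Nat.cast_pred (Nat.pos_of_ne_zero hn), Real.rpow_natCast,
      ENNReal.toReal_ofReal (by have := hy.2; have : 0 ≤ 1 - y := by linarith
                                positivity)]
  · rw [Set.indicator_of_notMem hy, betaPDF_eq, if_neg (by simpa using hy)]
    simp

/-- The case of two points of the Markov–Krein identity for Dirichlet distributions. -/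
lemma integral_betaMeasure_inv_pow {n : ℕ} (hn : n ≠ 0) {p q : ℂ} (hp : 0 < p.re)
    (hq : 0 < q.re) :
    ∫ y, (((1 - y) * p + y * q : ℂ)⁻¹) ^ (n + 1) ∂(betaMeasure 1 n) = p⁻¹ ^ n * q⁻¹ := by
  have hp0 : p ≠ 0 := fun h => by simp [h] at hp
  have hq0 : q ≠ 0 := fun h => by simp [h] at hq
  have hD : ∀ y ∈ Set.uIcc (0 : ℝ) 1, ((1 - y) * p + y * q : ℂ) ≠ 0 := fun y hy h => by
    rw [Set.uIcc_of_le zero_le_one] at hy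
    have := congrArg re h
    simp at this
    rcases hy.1.eq_or_lt with h0 | h0
    · rw [← h0] at this
      simp at this
      exact hp.ne' this
    · nlinarith [mul_pos h0 hq, mul_nonneg (sub_nonneg.2 hy.2) hp.le]
  rw [integral_betaMeasure_one_nat hn]
  have hderiv : ∀ y ∈ Set.uIcc (0 : ℝ) 1, HasDerivAt
      (fun y : ℝ => -q⁻¹ * ((1 - y) / ((1 - y) * p + y * q) : ℂ) ^ n)
      ((n * (1 - y) ^ (n - 1) : ℝ) • (((1 - y) * p + y * q : ℂ)⁻¹) ^ (n + 1)) y := fun y hy => by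
    have hy' := hD y hy
    have h1 : HasDerivAt (fun y : ℝ => (1 - y : ℂ)) (-1) y := by
      simpa using (hasDerivAt_id y).ofReal_comp.const_sub 1
    have h2 : HasDerivAt (fun y : ℝ => (y : ℂ)) 1 y := (hasDerivAt_id y).ofReal_comp
    refine (((h1.div ((h1.mul_const p).add (h2.mul_const q)) hy').pow n).const_mul
      (-q⁻¹)).congr_deriv ?_
    obtain ⟨n, rfl⟩ := Nat.exists_eq_succ_of_ne_zero hn
    rw [Complex.real_smul]
    simp only [Nat.succ_eq_add_one, Nat.add_sub_cancel, Pi.div_apply, Pi.add_apply]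
    push_cast
    have hnum : (-1 * ((1 - y) * p + y * q) - (1 - y) * (-1 * p + 1 * q) : ℂ) = -q := by ring
    rw [div_pow, inv_pow, hnum]
    generalize ((1 - y) * p + y * q : ℂ) = D at hy' ⊢
    field_simp
    ring
  rw [intervalIntegral.integral_eq_sub_of_hasDerivAt hderiv]
  · simp [hn]
    ring
  · refine ContinuousOn.intervalIntegrable ?_
    have hDc : ContinuousOn (fun y : ℝ => ((1 - y) * p + y * q : ℂ)) (Set.uIcc 0 1) := by
      fun_prop
    exact ContinuousOn.smul (f := fun y : ℝ => (n * (1 - y) ^ (n - 1) : ℝ)) (by fun_prop)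
      ((hDc.inv₀ hD).pow _)

/-- The moments of `(1 - i X)⁻¹` for the mean `X` of a Dirichlet random probability with integer
intensity. -/
lemma integral_halfCayley_pow_dirichletMeanLaw {α : Measure ℝ} (hα : FT₁ α) {n : ℕ}
    (hn : n ≠ 0) :
    ∫ x, halfCayley x ^ (n + 1) ∂(dirichletMeanLaw n α) =
      (∫ x, halfCayley x ^ n ∂(dirichletMeanLaw n α)) * ∫ x, halfCayley x ∂α := by
  have hn' : (0 : ℝ) < n := by positivity
  have := hα.isProbabilityMeasure
  have := isProbabilityMeasureBeta one_pos hn'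
  have := isProbabilityMeasure_dirichletMeanLaw hα hn'
  have hc := continuous_halfCayley
  set μ := dirichletMeanLaw n α with hμ
  have hrw : ∫ x, halfCayley x ^ (n + 1) ∂μ =
      ∫ q, halfCayley ((1 - q.1.2) * q.2 + q.1.2 * q.1.1) ^ (n + 1)
        ∂((α.prod (betaMeasure 1 n)).prod μ) := by
    conv_lhs => rw [hμ, dirichletMeanLaw_eq_map hα hn']
    exact integral_map (Measurable.aemeasurable (by fun_prop)) (by fun_prop)
  have hint : Integrable (fun q : (ℝ × ℝ) × ℝ =>
      halfCayley ((1 - q.1.2) * q.2 + q.1.2 * q.1.1) ^ (n + 1))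
      ((α.prod (betaMeasure 1 n)).prod μ) := by
    refine Integrable.of_bound (C := 1) (by fun_prop) (.of_forall fun q => ?_)
    rw [norm_pow]
    exact pow_le_one₀ (norm_nonneg _) (norm_halfCayley_le _)
  have hinner : ∀ x z : ℝ, ∫ y, halfCayley ((1 - y) * x + y * z) ^ (n + 1) ∂(betaMeasure 1 n) =
      halfCayley x ^ n * halfCayley z := fun x z => by
    rw [halfCayley, halfCayley, ← integral_betaMeasure_inv_pow hn (by simp) (by simp)]
    congr 1 with y
    rw [halfCayley]
    push_cast
    ring_nf
  rw [hrw, integral_prod_symm _ hint]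
  have hstep : ∀ x, ∫ p : ℝ × ℝ, halfCayley ((1 - p.2) * x + p.2 * p.1) ^ (n + 1)
      ∂(α.prod (betaMeasure 1 n)) = halfCayley x ^ n * ∫ z, halfCayley z ∂α := fun x => by
    rw [integral_prod]
    · simp_rw [hinner]
      rw [integral_const_mul]
    · refine Integrable.of_bound (C := 1) (by fun_prop) (.of_forall fun q => ?_)
      rw [norm_pow]
      exact pow_le_one₀ (norm_nonneg _) (norm_halfCayley_le _)
  simp_rw [hstep]
  rw [integral_mul_const]

end DirichletCurve

theorem proposition6p3 (α : MeasureTheory.Measure ℝ) (hα : DirichletCurve.FT₁ α) (N : ℤ)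
    (h : ∀ n : ℤ, 0 < n → N ≤ n → DirichletCurve.dirichletMeanLaw (n : ℝ) α = α) :
    DirichletCurve.IsCauchy α ∨ DirichletCurve.IsDirac α := by
  have := hα.isProbabilityMeasure
  refine DirichletCurve.isCauchy_or_isDirac_of_integral_cayley_pow
    (DirichletCurve.integral_cayley_pow_of_eventually (M := N.toNat + 1) fun n hn => ?_)
  have hn' : DirichletCurve.dirichletMeanLaw (n : ℝ) α = α := by
    simpa using h n (by omega) (by omega)
  have := DirichletCurve.integral_halfCayley_pow_dirichletMeanLaw hα (n := n) (by omega)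
  rwa [hn'] at this
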